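/- Let $\mathcal H$ be a finite-dimensional complex Hilbert space, $P$ an orthogonal projection on $\mathcal H$, and $Q = I - P$. For a density matrix $\rho$ on $\mathcal H$ (positive semidefinite, trace one) put $$A = P\rho P,\qquad B = P\rho Q,\qquad C = Q\rho Q,\qquad \Pi\rho = P\rho P + Q\rho Q,$$ and let $\|\cdot\|_F$ be the Frobenius norm. For density matrices $\rho,\sigma$ let $$D(\rho\|\sigma) = \operatorname{Tr}\bigl[\rho(\log\rho - \log\sigma)\bigr]$$ if $\operatorname{supp}\rho\subseteq\operatorname{supp}\sigma$ (natural logarithm, $0\log 0 = 0$), and $D(\rho\|\sigma) = +\infty$ otherwise. Suppose that $a_0 > 0$, that $A \ge a_0 P$ in the Loewner order, and that $\varepsilon_Q := \operatorname{Tr} C$ satisfies $0 < \varepsilon_Q \le a_0/2$. Then $$D(\rho\|\Pi\rho) \;\ge\; \|B\|_F^2\,\log\!\left(\frac{a_0}{\varepsilon_Q}\right).$$ Moreover, for every block-diagonal density matrix $\sigma$ (that is, $P\sigma Q = 0$ and $Q\sigma P = 0$), $$D(\rho\|\sigma) \;\ge\; D(\rho\|\Pi\rho), \qquad\text{and hence}\qquad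 D(\rho\|\sigma)\;\ge\;\|B\|_F^2\,\log\!\left(\frac{a_0}{\varepsilon_Q}\right).$$ -/

import Mathlib

open scoped ComplexOrder

namespace BlockEntropy

noncomputable section

variable {n : Type*} [Fintype n] [DecidableEq n]

/-- Density matrices: positive semidefinite complex matrices of trace one. -/
structure IsDensity (ρ : Matrix n n ℂ) : Prop where
  posSemidef : ρ.PosSemidef
  trace_eq_one : ρ.trace = 1

/-- The block `A = P ρ P`, regarded as an operator on the whole space. -/
def blockA (P ρ : Matrix n n ℂ) : Matrix n n ℂ := P * ρ * P

/-- The coherence block `B = P ρ Q` with `Q = 1 - P`. -/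
def blockB (P ρ : Matrix n n ℂ) : Matrix n n ℂ := P * ρ * (1 - P)

/-- The block `C = Q ρ Q` with `Q = 1 - P`. -/
def blockC (P ρ : Matrix n n ℂ) : Matrix n n ℂ := (1 - P) * ρ * (1 - P)

/-- The block-diagonal part `Π ρ = P ρ P + Q ρ Q`. -/
def pinching (P ρ : Matrix n n ℂ) : Matrix n n ℂ := blockA P ρ + blockC P ρ

/-- `σ` is block-diagonal with respect to `P` and `Q = 1 - P`: both off-diagonal blocks vanish. -/
def IsBlockDiagonal (P σ : Matrix n n ℂ) : Prop :=
  P * σ * (1 - P) = 0 ∧ (1 - P) * σ * P = 0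

/-- The squared Frobenius (Hilbert-Schmidt) norm. -/
def frobeniusSq (X : Matrix n n ℂ) : ℝ := ∑ i, ∑ j, ‖X i j‖ ^ 2

/-- The leakage `ε_Q = Tr C`, which is a real number for Hermitian `ρ` and `P`. -/
def leakage (P ρ : Matrix n n ℂ) : ℝ := (blockC P ρ).trace.re

open Classical in
/-- Umegaki relative entropy `D(ρ‖σ) = Tr ρ (log ρ - log σ)` of positive semidefinite matrices,
with natural logarithm, equal to `+∞` unless `supp ρ ⊆ supp σ`, that is `ker σ ⊆ ker ρ`.
The matrix logarithm is taken by functional calculus with the value `0` at eigenvalue `0`; under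
the support condition this convention does not affect the trace (it encodes `0 log 0 = 0`). -/
def relativeEntropy (ρ σ : Matrix n n ℂ) : EReal :=
  if ∀ v : n → ℂ, σ.mulVec v = 0 → ρ.mulVec v = 0 then
    (((ρ * (cfc Real.log ρ - cfc Real.log σ)).trace.re : ℝ) : EReal)
  else ⊤

end

end BlockEntropy

/-! Put `X = ρ - Πρ` and let `R` be `P` or `Q`. Since `R` commutes with `Πρ`, every `Tr f(ρ) R
g(Πρ)` is a sum of `f(x) g(y)` over eigenvalues `x` of `ρ` and `y` of `Πρ`, with nonnegative
weights. With `b = x (log x - log y) - x + y ≥ 0`, `b ± (x log x - y log y)(x - y) = (1 ± (x - y)) b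
± (1 + log y)(x - y)²`, and `1 ± (x - y) ≥ 0` because `x, y` lie in `[0, 1]`. Use `+` on `P`, where
`y ≥ a₀`, and `-` on `Q`, where `y ≤ ε_Q`. In the weighted sums `(x - y)²` gives `‖B‖_F²` on each
block, while `x - y` and `(x - y) y log y` give zero because `R X R = 0`. The remaining terms `± Tr
ρ log ρ X R` have equal real parts up to sign and cancel, leaving the factor `log a₀ - log ε_Q`
(`frobeniusSq_mul_log_le`).

For block-diagonal `σ`, `D(ρ‖σ) - D(ρ‖Πρ) = D(Πρ‖σ)` when finite, and Klein's inequality applies. -/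

namespace BlockEntropy

open Matrix

/-! ### Joint spectral expansions of traces. -/

section Spectral

variable {n : Type*} [Fintype n] [DecidableEq n] {ρ σ R : Matrix n n ℂ}

/-- The squared modulus of `⟪u i, R v j⟫`, for the eigenvector bases `u` of `ρ` and `v` of `σ`. -/
noncomputable def overlap (hρ : ρ.IsHermitian) (hσ : σ.IsHermitian) (R : Matrix n n ℂ)
    (i j : n) : ℝ :=
  Complex.normSq
    ((star (hρ.eigenvectorUnitary : Matrix n n ℂ) * R * (hσ.eigenvectorUnitary : Matrix n n ℂ)) i j)

lemma overlap_nonneg (hρ : ρ.IsHermitian) (hσ : σ.IsHermitian) (R : Matrix n n ℂ) (i j : n) :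
    0 ≤ overlap hρ hσ R i j :=
  Complex.normSq_nonneg _

lemma trace_diagonal_mul_mul_diagonal_mul_conjTranspose (f g : n → ℂ) (M : Matrix n n ℂ) :
    (diagonal f * M * diagonal g * Mᴴ).trace
      = ∑ i, ∑ j, (Complex.normSq (M i j) : ℂ) * (f i * g j) := by
  simp only [trace, diag_apply, mul_apply (N := Mᴴ), mul_diagonal, diagonal_mul,
    conjTranspose_apply, RCLike.star_def, Complex.normSq_eq_conj_mul_self]
  refine Finset.sum_congr rfl fun i _ => Finset.sum_congr rfl fun j _ => by ring

lemma cfc_mul_cfc (ρ : Matrix n n ℂ) (f g : ℝ → ℝ) :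
    cfc f ρ * cfc g ρ = cfc (fun x => f x * g x) ρ :=
  (cfc_mul f g ρ (Matrix.finite_real_spectrum.continuousOn _)
    (Matrix.finite_real_spectrum.continuousOn _)).symm

lemma cfc_id_matrix (hρ : ρ.IsHermitian) : cfc (fun x : ℝ => x) ρ = ρ :=
  cfc_id' ℝ ρ hρ

lemma cfc_one_matrix (hρ : ρ.IsHermitian) : cfc (fun _ : ℝ => (1 : ℝ)) ρ = 1 :=
  cfc_const_one ℝ ρ hρ

lemma isHermitian_cfc (ρ : Matrix n n ℂ) (f : ℝ → ℝ) : (cfc f ρ).IsHermitian :=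
  cfc_predicate (p := IsSelfAdjoint) f ρ

/-- Joint spectral expansion of `Tr f(ρ) R g(σ)`. -/
lemma re_trace_cfc_mul_mul_cfc (hρ : ρ.IsHermitian) (hσ : σ.IsHermitian)
    (hR : IsStarProjection R) (hc : Commute σ R) (f g : ℝ → ℝ) :
    (cfc f ρ * R * cfc g σ).trace.re
      = ∑ i, ∑ j, overlap hρ hσ R i j * (f (hρ.eigenvalues i) * g (hσ.eigenvalues j)) := by
  -- The second `R` turns the trace into `Tr F M G Mᴴ` with `F`, `G` diagonal and `M = U* R V`, so
  -- the weights are squared moduli.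
  have h1 : cfc f ρ * R * cfc g σ = cfc f ρ * R * cfc g σ * R := by
    have h2 : cfc g σ * R = R * cfc g σ := (hc.cfc_real g).eq
    have h3 : R * R = R := hR.isIdempotentElem
    rw [mul_assoc, mul_assoc, mul_assoc, h2, ← mul_assoc R R, h3]
  have hRs : Rᴴ = R := hR.isSelfAdjoint
  set U := (hρ.eigenvectorUnitary : Matrix n n ℂ) with hU
  set V := (hσ.eigenvectorUnitary : Matrix n n ℂ) with hV
  have key : (cfc f ρ * R * cfc g σ * R).trace
      = (diagonal (fun i => (f (hρ.eigenvalues i) : ℂ)) * (star U * R * V)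
          * diagonal (fun i => (g (hσ.eigenvalues i) : ℂ)) * (star U * R * V)ᴴ).trace := by
    have e1 : cfc f ρ = U * diagonal (fun i => (f (hρ.eigenvalues i) : ℂ)) * star U := by
      rw [hρ.cfc_eq f, IsHermitian.cfc, Unitary.conjStarAlgAut_apply]; rfl
    have e2 : cfc g σ = V * diagonal (fun i => (g (hσ.eigenvalues i) : ℂ)) * star V := by
      rw [hσ.cfc_eq g, IsHermitian.cfc, Unitary.conjStarAlgAut_apply]; rfl
    rw [e1, e2, conjTranspose_mul, conjTranspose_mul, hRs]
    simp only [star_eq_conjTranspose, conjTranspose_conjTranspose, mul_assoc]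
    rw [trace_mul_comm U]
    simp only [mul_assoc]
  rw [h1, key, trace_diagonal_mul_mul_diagonal_mul_conjTranspose]
  simp only [Complex.re_sum, overlap, ← hU, ← hV]
  refine Finset.sum_congr rfl fun i _ => Finset.sum_congr rfl fun j _ => ?_
  rw [← Complex.ofReal_mul, ← Complex.ofReal_mul, Complex.ofReal_re]

lemma re_trace_cfc_mul_sub_mul_cfc (hρ : ρ.IsHermitian) (hσ : σ.IsHermitian)
    (hR : IsStarProjection R) (hc : Commute σ R) (f g : ℝ → ℝ) :
    (cfc f ρ * (ρ - σ) * R * cfc g σ).trace.re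
      = ∑ i, ∑ j, overlap hρ hσ R i j * (f (hρ.eigenvalues i) *
          (hρ.eigenvalues i - hσ.eigenvalues j) * g (hσ.eigenvalues j)) := by
  have h : cfc f ρ * (ρ - σ) * R * cfc g σ
      = cfc (fun x => f x * x) ρ * R * cfc g σ - cfc f ρ * R * cfc (fun x => x * g x) σ := by
    rw [← cfc_mul_cfc ρ f (fun x => x), ← cfc_mul_cfc σ (fun x => x) g,
      cfc_id_matrix hρ, cfc_id_matrix hσ]
    simp only [mul_sub, sub_mul, mul_assoc]
    rw [← mul_assoc σ R, hc.eq, mul_assoc]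
  rw [h, trace_sub, Complex.sub_re, re_trace_cfc_mul_mul_cfc hρ hσ hR hc,
    re_trace_cfc_mul_mul_cfc hρ hσ hR hc, ← Finset.sum_sub_distrib]
  refine Finset.sum_congr rfl fun i _ => ?_
  rw [← Finset.sum_sub_distrib]
  refine Finset.sum_congr rfl fun j _ => by ring

/-- The part of `Tr ρ (log ρ - log σ)` carried by `R`. -/
lemma re_trace_relative_part (hρ : ρ.IsHermitian) (hσ : σ.IsHermitian)
    (hR : IsStarProjection R) (hc : Commute σ R) :
    (ρ * (cfc Real.log ρ - cfc Real.log σ) * R).trace.re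
      = ∑ i, ∑ j, overlap hρ hσ R i j * (hρ.eigenvalues i *
          (Real.log (hρ.eigenvalues i) - Real.log (hσ.eigenvalues j))) := by
  have h : ρ * (cfc Real.log ρ - cfc Real.log σ) * R
      = cfc (fun x => x * Real.log x) ρ * R * cfc (fun _ => (1 : ℝ)) σ
        - cfc (fun x : ℝ => x) ρ * R * cfc Real.log σ := by
    rw [← cfc_mul_cfc ρ (fun x => x), cfc_id_matrix hρ, cfc_one_matrix hσ]
    simp only [mul_sub, sub_mul, mul_assoc, mul_one]
    rw [(hc.cfc_real Real.log).eq]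
  rw [h, trace_sub, Complex.sub_re, re_trace_cfc_mul_mul_cfc hρ hσ hR hc,
    re_trace_cfc_mul_mul_cfc hρ hσ hR hc, ← Finset.sum_sub_distrib]
  refine Finset.sum_congr rfl fun i _ => ?_
  rw [← Finset.sum_sub_distrib]
  refine Finset.sum_congr rfl fun j _ => by ring

/-- The witness is `R v_j`, which stays in the eigenspace because `σ` commutes with `R`. The
eigenbasis of `σ` thus need not be adapted to `R`, and bounds on a block control every eigenvalue of
nonzero weight. -/
lemma exists_eigenvector_of_overlap_ne_zero (hρ : ρ.IsHermitian) (hσ : σ.IsHermitian)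
    (hR : IsStarProjection R) (hc : Commute σ R) {i j : n} (h : overlap hρ hσ R i j ≠ 0) :
    ∃ v : n → ℂ, v ≠ 0 ∧ R *ᵥ v = v ∧ σ *ᵥ v = (hσ.eigenvalues j : ℂ) • v ∧
      (ρ *ᵥ v = 0 → hρ.eigenvalues i = 0) := by
  set w : n → ℂ := (hσ.eigenvectorBasis j).ofLp with hw
  have hent : (star (hρ.eigenvectorUnitary : Matrix n n ℂ) *ᵥ (R *ᵥ w)) i ≠ 0 := by
    intro h0
    apply h
    rw [overlap, Complex.normSq_eq_zero, ← h0, mulVec_mulVec]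
    rfl
  refine ⟨R *ᵥ w, ?_, ?_, ?_, ?_⟩
  · intro h0
    rw [h0, mulVec_zero] at hent
    exact hent rfl
  · rw [mulVec_mulVec, hR.isIdempotentElem.eq]
  · rw [mulVec_mulVec, hc.eq, ← mulVec_mulVec, hw, hσ.mulVec_eigenvectorBasis, mulVec_smul]
    rfl
  · intro h0
    have e1 : star (hρ.eigenvectorUnitary : Matrix n n ℂ) * ρ
        = diagonal (fun i => (hρ.eigenvalues i : ℂ)) *
          star (hρ.eigenvectorUnitary : Matrix n n ℂ) := by
      have hs := congrArg (star (hρ.eigenvectorUnitary : Matrix n n ℂ) * ·) hρ.spectral_theorem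
      rw [Unitary.conjStarAlgAut_apply] at hs
      refine hs.trans ?_
      rw [← mul_assoc, ← mul_assoc, Unitary.coe_star_mul_self, one_mul]
      rfl
    have e2 : (star (hρ.eigenvectorUnitary : Matrix n n ℂ) *ᵥ (ρ *ᵥ (R *ᵥ w))) i
        = hρ.eigenvalues i *
          (star (hρ.eigenvectorUnitary : Matrix n n ℂ) *ᵥ (R *ᵥ w)) i := by
      rw [mulVec_mulVec, e1, ← mulVec_mulVec, mulVec_diagonal]
    rw [h0, mulVec_zero] at e2
    have e3 := (mul_eq_zero.mp e2.symm).resolve_right hent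
    exact_mod_cast e3

lemma eigenvalues_le_re_trace {A : Matrix n n ℂ} (hA : A.PosSemidef) (i : n) :
    hA.1.eigenvalues i ≤ A.trace.re := by
  have h : A.trace.re = ∑ i, hA.1.eigenvalues i := by
    rw [hA.1.trace_eq_sum_eigenvalues]; simp
  rw [h]
  exact Finset.single_le_sum (fun j _ => hA.eigenvalues_nonneg j) (Finset.mem_univ i)

lemma le_re_trace_of_mulVec_eq_smul {A : Matrix n n ℂ} (hA : A.PosSemidef) {v : n → ℂ}
    (hv : v ≠ 0) {μ : ℝ} (h : A *ᵥ v = (μ : ℂ) • v) : μ ≤ A.trace.re := by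
  have hmem : μ ∈ spectrum ℝ A := by
    rw [spectrum.mem_iff]
    intro hu
    apply hv
    apply Matrix.mulVec_injective_of_isUnit hu
    rw [mulVec_zero, sub_mulVec, h, Algebra.algebraMap_eq_smul_one, smul_mulVec, one_mulVec]
    ext k
    simp
  rw [hA.1.spectrum_real_eq_range_eigenvalues] at hmem
  obtain ⟨i, rfl⟩ := hmem
  exact eigenvalues_le_re_trace hA i

end Spectral

/-! ### Scalar inequalities for the entropy function. -/

section Scalar

lemma bregman_nonneg {x y : ℝ} (hx : 0 ≤ x) (hy : 0 ≤ y) (h : y = 0 → x = 0) :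
    0 ≤ x * (Real.log x - Real.log y) - x + y := by
  rcases hx.eq_or_lt with rfl | hx
  · simpa using hy
  have hy' : 0 < y := hy.lt_of_ne fun h0 => hx.ne' (h h0.symm)
  have h1 := Real.one_sub_inv_le_log_of_pos (div_pos hx hy')
  rw [Real.log_div hx.ne' hy'.ne', inv_div] at h1
  have h2 := mul_le_mul_of_nonneg_left h1 hx.le
  have h3 : x * (1 - y / x) = x - y := by field_simp
  linarith

/-- The right side equals `(1 + x - y) b + (1 + log y)(x - y)²`, with `b` the expression in
`bregman_nonneg`. -/
lemma log_mul_sq_le_bregman_add {a x y : ℝ} (ha : 0 < a) (hx : 0 ≤ x) (hay : a ≤ y)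
    (hy1 : y ≤ 1) :
    (1 + Real.log a) * (x - y) ^ 2 ≤ x * (Real.log x - Real.log y) - (x - y)
      + (x * Real.log x - y * Real.log y) * (x - y) := by
  have hy : 0 < y := ha.trans_le hay
  have h1 := mul_nonneg (by linarith : 0 ≤ 1 + x - y)
    (bregman_nonneg hx hy.le fun h => absurd h hy.ne')
  have h2 := mul_le_mul_of_nonneg_right (Real.log_le_log ha hay) (sq_nonneg (x - y))
  nlinarith

lemma neg_log_mul_sq_le_bregman_sub {e x y : ℝ} (hx : 0 ≤ x) (hx1 : x ≤ 1) (hy : 0 ≤ y)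
    (hye : y ≤ e) (h : y = 0 → x = 0) :
    -(1 + Real.log e) * (x - y) ^ 2 ≤ x * (Real.log x - Real.log y) - (x - y)
      - (x * Real.log x - y * Real.log y) * (x - y) := by
  -- `Real.log 0 = 0` breaks monotonicity of the logarithm at `y = 0`, but there `x = 0` and both
  -- sides vanish.
  rcases hy.eq_or_lt with h0 | hy
  · rw [← h0, h h0.symm]; simp
  have h1 := mul_nonneg (by linarith : 0 ≤ 1 - x + y) (bregman_nonneg hx hy.le h)
  have h2 := mul_le_mul_of_nonneg_right (Real.log_le_log hy hye) (sq_nonneg (x - y))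
  nlinarith

end Scalar

/-! ### Block algebra and supports of the pinching. -/

section Blocks

variable {n : Type*} [Fintype n] [DecidableEq n] {P R ρ σ : Matrix n n ℂ}

lemma sum_overlap_mul_sub_sq (hρ : ρ.IsHermitian) (hσ : σ.IsHermitian)
    (hR : IsStarProjection R) (hc : Commute σ R) :
    ∑ i, ∑ j, overlap hρ hσ R i j * (hρ.eigenvalues i - hσ.eigenvalues j) ^ 2
      = ((ρ - σ) * (ρ - σ) * R).trace.re := by
  have h1 := re_trace_cfc_mul_sub_mul_cfc hρ hσ hR hc (fun x => x) (fun _ => 1)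
  have h2 := re_trace_cfc_mul_sub_mul_cfc hρ hσ hR hc (fun _ => 1) (fun x => x)
  rw [cfc_id_matrix hρ, cfc_one_matrix hσ, mul_one] at h1
  rw [cfc_id_matrix hσ, cfc_one_matrix hρ, one_mul, trace_mul_comm, ← mul_assoc] at h2
  rw [sub_mul, sub_mul, trace_sub, Complex.sub_re, h1, h2, ← Finset.sum_sub_distrib]
  refine Finset.sum_congr rfl fun i _ => ?_
  rw [← Finset.sum_sub_distrib]
  refine Finset.sum_congr rfl fun j _ => by ring

lemma sum_overlap_mul_sub_mul (hρ : ρ.IsHermitian) (hσ : σ.IsHermitian)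
    (hR : IsStarProjection R) (hc : Commute σ R) (h0 : R * (ρ - σ) * R = 0) (g : ℝ → ℝ) :
    ∑ i, ∑ j, overlap hρ hσ R i j *
      ((hρ.eigenvalues i - hσ.eigenvalues j) * g (hσ.eigenvalues j)) = 0 := by
  have h1 := re_trace_cfc_mul_sub_mul_cfc hρ hσ hR hc (fun _ => 1) g
  rw [cfc_one_matrix hρ, one_mul] at h1
  -- With a second `R` on the right, cyclicity exposes `R (ρ - σ) R = 0`.
  have h2 : (ρ - σ) * R * cfc g σ = (ρ - σ) * R * cfc g σ * R := by
    rw [mul_assoc, mul_assoc, mul_assoc, (hc.cfc_real g).eq, ← mul_assoc R R,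
      hR.isIdempotentElem.eq]
  rw [h2, trace_mul_comm, ← mul_assoc, ← mul_assoc, h0, zero_mul, trace_zero] at h1
  simpa using h1.symm

lemma frobeniusSq_eq (X : Matrix n n ℂ) : frobeniusSq X = (Xᴴ * X).trace.re := by
  rw [trace_mul_comm]
  simp only [frobeniusSq, trace, diag_apply, mul_apply, conjTranspose_apply, Complex.re_sum,
    RCLike.star_def, Complex.mul_conj, Complex.ofReal_re, Complex.normSq_eq_norm_sq]

lemma IsBlockDiagonal.commute (hσ : IsBlockDiagonal P σ) : Commute σ P := by
  have h1 := hσ.1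
  have h2 := hσ.2
  simp only [mul_sub, sub_mul, mul_one, one_mul] at h1 h2
  exact (sub_eq_zero.mp h2).trans (sub_eq_zero.mp h1).symm

lemma _root_.IsStarProjection.mul_self_mul (hP : IsStarProjection P) (X : Matrix n n ℂ) :
    P * (P * X) = P * X := by
  rw [← mul_assoc, hP.isIdempotentElem.eq]

lemma isBlockDiagonal_pinching (hP : IsStarProjection P) (ρ : Matrix n n ℂ) :
    IsBlockDiagonal P (pinching P ρ) := by
  have h1 := hP.isIdempotentElem.eq
  have h2 := hP.mul_self_mul
  constructor <;>
  · simp only [pinching, blockA, blockC, mul_add, add_mul, mul_sub, sub_mul, mul_one, one_mul,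
      mul_assoc, h1, h2]
    abel

lemma sub_pinching_mul (hP : IsStarProjection P) (hρ : ρ.IsHermitian) :
    (ρ - pinching P ρ) * P = (blockB P ρ)ᴴ := by
  have h1 := hP.isIdempotentElem.eq
  have h2 := hP.mul_self_mul
  have h3 : Pᴴ = P := hP.isSelfAdjoint
  have h4 : ρᴴ = ρ := hρ
  simp only [pinching, blockA, blockB, blockC, conjTranspose_mul, conjTranspose_sub,
    h3, h4, add_mul, mul_sub, sub_mul, mul_one, one_mul, mul_assoc, h1]
  abel

lemma sub_pinching_mul_one_sub (hP : IsStarProjection P) (ρ : Matrix n n ℂ) :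
    (ρ - pinching P ρ) * (1 - P) = blockB P ρ := by
  have h1 := hP.isIdempotentElem.eq
  have h2 := hP.mul_self_mul
  simp only [pinching, blockA, blockB, blockC, add_mul, mul_sub, sub_mul, mul_one,
    one_mul, mul_assoc, h1]
  abel

lemma mul_blockB (hP : IsStarProjection P) (ρ : Matrix n n ℂ) :
    (1 - P) * blockB P ρ = 0 := by
  rw [blockB, ← mul_assoc, ← mul_assoc, hP.one_sub_mul_self, zero_mul, zero_mul]

lemma blockB_mul (hP : IsStarProjection P) (ρ : Matrix n n ℂ) : blockB P ρ * P = 0 := by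
  rw [blockB, mul_assoc, hP.one_sub_mul_self, mul_zero]

lemma mul_conjTranspose_blockB (hP : IsStarProjection P) (ρ : Matrix n n ℂ) :
    P * (blockB P ρ)ᴴ = 0 := by
  have h3 : Pᴴ = P := hP.isSelfAdjoint
  rw [← conjTranspose_conjTranspose (P * (blockB P ρ)ᴴ), conjTranspose_mul,
    conjTranspose_conjTranspose, h3, blockB_mul hP, conjTranspose_zero]

lemma posSemidef_blockA (hP : IsStarProjection P) (hρ : ρ.PosSemidef) :
    (blockA P ρ).PosSemidef := by
  have h3 : Pᴴ = P := hP.isSelfAdjoint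
  simpa [blockA, h3] using hρ.conjTranspose_mul_mul_same P

lemma posSemidef_blockC (hP : IsStarProjection P) (hρ : ρ.PosSemidef) :
    (blockC P ρ).PosSemidef :=
  posSemidef_blockA hP.one_sub hρ

lemma posSemidef_pinching (hP : IsStarProjection P) (hρ : ρ.PosSemidef) :
    (pinching P ρ).PosSemidef :=
  (posSemidef_blockA hP hρ).add (posSemidef_blockC hP hρ)

lemma trace_blockA_mul (hP : IsStarProjection P) {G : Matrix n n ℂ} (hG : Commute G P) :
    (blockA P ρ * G).trace = (ρ * G * P).trace := by
  rw [blockA, mul_assoc P, mul_assoc P, trace_mul_comm, mul_assoc ρ, ← hG.eq, ← mul_assoc,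
    mul_assoc, hP.isIdempotentElem.eq]

lemma trace_pinching_mul (hP : IsStarProjection P) {G : Matrix n n ℂ} (hG : Commute G P) :
    (pinching P ρ * G).trace = (ρ * G).trace := by
  have hQ : Commute G (1 - P) := (Commute.one_right _).sub_right hG
  change ((blockA P ρ + blockA (1 - P) ρ) * G).trace = _
  rw [add_mul, trace_add, trace_blockA_mul hP hG, trace_blockA_mul hP.one_sub hQ, ← trace_add,
    ← mul_add, add_sub_cancel, mul_one]

lemma isDensity_pinching (hP : IsStarProjection P) (hρ : IsDensity ρ) :
    IsDensity (pinching P ρ) where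
  posSemidef := posSemidef_pinching hP hρ.posSemidef
  trace_eq_one := by
    have h := trace_pinching_mul (ρ := ρ) hP (Commute.one_left P)
    rwa [mul_one, mul_one, hρ.trace_eq_one] at h

lemma mulVec_eq_zero_of_blockA (hP : IsStarProjection P) (hρ : ρ.PosSemidef) {v : n → ℂ}
    (h : blockA P ρ *ᵥ v = 0) : ρ *ᵥ (P *ᵥ v) = 0 := by
  have h3 : Pᴴ = P := hP.isSelfAdjoint
  rw [← hρ.dotProduct_mulVec_zero_iff, star_mulVec, h3, ← dotProduct_mulVec, mulVec_mulVec,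
    mulVec_mulVec]
  change star v ⬝ᵥ (blockA P ρ *ᵥ v) = 0
  rw [h, dotProduct_zero]

lemma mul_pinching (hP : IsStarProjection P) (ρ : Matrix n n ℂ) :
    P * pinching P ρ = blockA P ρ := by
  have h2 := hP.mul_self_mul
  simp only [pinching, blockA, blockC, mul_add, mul_sub, sub_mul, mul_one, one_mul, mul_assoc,
    h2]
  abel

lemma one_sub_mul_pinching (hP : IsStarProjection P) (ρ : Matrix n n ℂ) :
    (1 - P) * pinching P ρ = blockC P ρ := by
  rw [sub_mul, one_mul, mul_pinching hP, pinching, add_sub_cancel_left]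

/-- `supp ρ ⊆ supp Πρ`. -/
lemma mulVec_eq_zero_of_pinching (hP : IsStarProjection P) (hρ : ρ.PosSemidef) {v : n → ℂ}
    (h : pinching P ρ *ᵥ v = 0) : ρ *ᵥ v = 0 := by
  have h1 : blockA P ρ *ᵥ v = 0 := by
    rw [← mul_pinching hP, ← mulVec_mulVec, h, mulVec_zero]
  have h2 : blockA (1 - P) ρ *ᵥ v = 0 := by
    change blockC P ρ *ᵥ v = 0
    rw [← one_sub_mul_pinching hP, ← mulVec_mulVec, h, mulVec_zero]
  have h3 := mulVec_eq_zero_of_blockA hP hρ h1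
  have h4 := mulVec_eq_zero_of_blockA hP.one_sub hρ h2
  rw [sub_mulVec, one_mulVec, mulVec_sub, h3, sub_zero] at h4
  exact h4

lemma pinching_mulVec_eq_zero (hσ : IsBlockDiagonal P σ)
    (h : ∀ v : n → ℂ, σ *ᵥ v = 0 → ρ *ᵥ v = 0) (v : n → ℂ) (hv : σ *ᵥ v = 0) :
    pinching P ρ *ᵥ v = 0 := by
  have h1 : σ *ᵥ (P *ᵥ v) = 0 := by
    rw [mulVec_mulVec, hσ.commute.eq, ← mulVec_mulVec, hv, mulVec_zero]
  have h2 : σ *ᵥ ((1 - P) *ᵥ v) = 0 := by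
    rw [sub_mulVec, one_mulVec, mulVec_sub, h1, hv, sub_zero]
  simp only [pinching, blockA, blockC, add_mulVec, ← mulVec_mulVec, h _ h1, h _ h2, mulVec_zero,
    add_zero]

end Blocks

/-! ### The coherence bound and optimality of the pinched state. -/

section Main

variable {n : Type*} [Fintype n] [DecidableEq n] {P R ρ σ : Matrix n n ℂ}

/-- Averages the scalar inequality against the overlaps. The sign `s` is `1` on `P` and `-1` on `Q`.
-/
lemma mul_sum_overlap_sub_sq_le (hρ : ρ.IsHermitian) (hσ : σ.IsHermitian)
    (hR : IsStarProjection R) (hc : Commute σ R) (h0 : R * (ρ - σ) * R = 0) {k s : ℝ}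
    (h : ∀ i j, overlap hρ hσ R i j ≠ 0 → ∀ x y, x = hρ.eigenvalues i → y = hσ.eigenvalues j →
      k * (x - y) ^ 2 ≤ x * (Real.log x - Real.log y) - (x - y)
        + s * ((x * Real.log x - y * Real.log y) * (x - y))) :
    k * ((ρ - σ) * (ρ - σ) * R).trace.re
      ≤ (ρ * (cfc Real.log ρ - cfc Real.log σ) * R).trace.re
        + s * (cfc (fun x => x * Real.log x) ρ * ((ρ - σ) * R)).trace.re := by
  have e1 := sum_overlap_mul_sub_sq hρ hσ hR hc
  have e2 := sum_overlap_mul_sub_mul hρ hσ hR hc h0 (fun _ => 1)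
  have e3 := sum_overlap_mul_sub_mul hρ hσ hR hc h0 (fun x => x * Real.log x)
  have e4 := re_trace_cfc_mul_sub_mul_cfc hρ hσ hR hc (fun x => x * Real.log x) (fun _ => 1)
  have e5 := re_trace_relative_part hρ hσ hR hc
  rw [cfc_one_matrix hσ, mul_one, mul_assoc] at e4
  rw [← e1, e5, e4, ← sub_zero (∑ i, ∑ j, overlap hρ hσ R i j * (hρ.eigenvalues i * _)), ← e2,
    ← sub_zero (∑ i, ∑ j, overlap hρ hσ R i j * (hρ.eigenvalues i * _ * _ * _)), ← e3]
  simp only [Finset.mul_sum, ← Finset.sum_add_distrib, ← Finset.sum_sub_distrib]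
  refine Finset.sum_le_sum fun i _ => Finset.sum_le_sum fun j _ => ?_
  by_cases hw : overlap hρ hσ R i j = 0
  · simp [hw]
  · have := mul_le_mul_of_nonneg_left (h i j hw _ _ rfl rfl) (overlap_nonneg hρ hσ R i j)
    linarith

/-- The coherence bound for the relative entropy to the pinched state, as a real inequality. -/
lemma frobeniusSq_mul_log_le (hP : IsStarProjection P) (hρ : IsDensity ρ) {a : ℝ} (ha : 0 < a)
    (hA : (blockA P ρ - (a : ℂ) • P).PosSemidef) (hε : 0 < leakage P ρ) :
    frobeniusSq (blockB P ρ) * Real.log (a / leakage P ρ)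
      ≤ (ρ * (cfc Real.log ρ - cfc Real.log (pinching P ρ))).trace.re := by
  have hρH := hρ.posSemidef.1
  have hσD := isDensity_pinching hP hρ
  have hσH := hσD.posSemidef.1
  have hc := (isBlockDiagonal_pinching hP ρ).commute
  have hcQ : Commute (pinching P ρ) (1 - P) := (Commute.one_right _).sub_right hc
  have hX := sub_pinching_mul hP hρH
  have hXQ := sub_pinching_mul_one_sub hP ρ
  have hPH : Pᴴ = P := hP.isSelfAdjoint
  have hXH : (ρ - pinching P ρ)ᴴ = ρ - pinching P ρ := hρH.sub hσH
  have hρ1 : ∀ i, hρH.eigenvalues i ≤ 1 := fun i => by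
    simpa [hρ.trace_eq_one] using eigenvalues_le_re_trace hρ.posSemidef i
  have hσ1 : ∀ i, hσH.eigenvalues i ≤ 1 := fun i => by
    simpa [hσD.trace_eq_one] using eigenvalues_le_re_trace hσD.posSemidef i
  have hρ0 := hρ.posSemidef.eigenvalues_nonneg
  have hσ0 := hσD.posSemidef.eigenvalues_nonneg
  have bP := mul_sum_overlap_sub_sq_le hρH hσH hP hc (k := 1 + Real.log a) (s := 1)
    (by rw [mul_assoc, hX, mul_conjTranspose_blockB hP]) (by
      rintro i j hw x y rfl rfl
      rw [one_mul]
      refine log_mul_sq_le_bregman_add ha (hρ0 i) ?_ (hσ1 j)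
      obtain ⟨v, hv0, hPv, hσv, -⟩ := exists_eigenvector_of_overlap_ne_zero hρH hσH hP hc hw
      -- As `v` lies in the range of `P`, it is an eigenvector of `A` too, so `A ≥ a P` bounds its
      -- eigenvalue below.
      have h1 : blockA P ρ *ᵥ v = (hσH.eigenvalues j : ℂ) • v := by
        rw [← mul_pinching hP, ← mulVec_mulVec, hσv, mulVec_smul, hPv]
      have h2 := hA.dotProduct_mulVec_nonneg v
      rw [sub_mulVec, h1, smul_mulVec, hPv, ← sub_smul, dotProduct_smul, smul_eq_mul,
        ← Complex.ofReal_sub] at h2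
      have h3 : 0 < star v ⬝ᵥ v := dotProduct_star_self_pos_iff.mpr hv0
      replace h2 := (Complex.nonneg_iff.mp h2).1
      rw [Complex.re_ofReal_mul] at h2
      linarith [nonneg_of_mul_nonneg_left h2 (Complex.pos_iff.mp h3).1])
  have bQ := mul_sum_overlap_sub_sq_le hρH hσH hP.one_sub hcQ
    (k := -(1 + Real.log (leakage P ρ))) (s := -1)
    (by rw [mul_assoc, hXQ, mul_blockB hP]) (by
      rintro i j hw x y rfl rfl
      rw [neg_one_mul, ← sub_eq_add_neg]
      obtain ⟨v, hv0, hQv, hσv, hρv⟩ :=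
        exists_eigenvector_of_overlap_ne_zero hρH hσH hP.one_sub hcQ hw
      refine neg_log_mul_sq_le_bregman_sub (hρ0 i) (hρ1 i) (hσ0 j) ?_ fun h0 => hρv ?_
      · refine le_re_trace_of_mulVec_eq_smul (posSemidef_blockC hP hρ.posSemidef) hv0 ?_
        rw [← one_sub_mul_pinching hP, ← mulVec_mulVec, hσv, mulVec_smul, hQv]
      · apply mulVec_eq_zero_of_pinching hP hρ.posSemidef
        rw [hσv, h0, Complex.ofReal_zero, zero_smul])
  have fQ : ((ρ - pinching P ρ) * (ρ - pinching P ρ) * (1 - P)).trace.re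
      = frobeniusSq (blockB P ρ) := by
    have h1 : (1 - P) * (ρ - pinching P ρ) = (blockB P ρ)ᴴ := by
      rw [← hXQ, conjTranspose_mul, hXH, conjTranspose_sub, conjTranspose_one, hPH]
    have h2 : blockB P ρ * (1 - P) = blockB P ρ := by
      rw [mul_sub, blockB_mul hP, mul_one, sub_zero]
    rw [frobeniusSq_eq, mul_assoc, hXQ, ← h1]
    nth_rw 1 [← h2]
    rw [← mul_assoc, trace_mul_comm, ← mul_assoc]
  have fP : ((ρ - pinching P ρ) * (ρ - pinching P ρ) * P).trace.re
      = frobeniusSq (blockB P ρ) := by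
    have h1 : P * (ρ - pinching P ρ) = blockB P ρ := by
      rw [← conjTranspose_conjTranspose (blockB P ρ), ← hX, conjTranspose_mul, hXH, hPH]
    have h2 : (blockB P ρ)ᴴ * P = (blockB P ρ)ᴴ := by
      rw [← hX, mul_assoc, hP.isIdempotentElem.eq]
    rw [mul_assoc, hX, ← h2, ← mul_assoc, trace_mul_comm, ← mul_assoc, h1, trace_mul_comm,
      frobeniusSq_eq]
  -- These traces are complex conjugates, so the correction terms of the two blocks cancel.
  have hT : (cfc (fun x => x * Real.log x) ρ * (blockB P ρ)ᴴ).trace.re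
      = (cfc (fun x => x * Real.log x) ρ * blockB P ρ).trace.re := by
    have h1 : (cfc (fun x => x * Real.log x) ρ)ᴴ = cfc (fun x => x * Real.log x) ρ :=
      isHermitian_cfc ρ _
    rw [← h1, ← conjTranspose_mul, trace_conjTranspose, h1, trace_mul_comm]
    simp
  have hD : (ρ * (cfc Real.log ρ - cfc Real.log (pinching P ρ))).trace.re
      = (ρ * (cfc Real.log ρ - cfc Real.log (pinching P ρ)) * P).trace.re
        + (ρ * (cfc Real.log ρ - cfc Real.log (pinching P ρ)) * (1 - P)).trace.re := by
    rw [← Complex.add_re, ← trace_add, ← mul_add, add_sub_cancel, mul_one]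
  rw [fP, hX, hT] at bP
  rw [fQ, hXQ] at bQ
  rw [hD, Real.log_div ha.ne' hε.ne']
  linarith

/-- **Klein's inequality**. -/
lemma re_trace_relative_nonneg (hρ : IsDensity ρ) (hσ : IsDensity σ)
    (h : ∀ v : n → ℂ, σ *ᵥ v = 0 → ρ *ᵥ v = 0) :
    0 ≤ (ρ * (cfc Real.log ρ - cfc Real.log σ)).trace.re := by
  have hρH := hρ.posSemidef.1
  have hσH := hσ.posSemidef.1
  have h1 : IsStarProjection (1 : Matrix n n ℂ) := .one _
  have hc : Commute σ 1 := Commute.one_right σ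
  have e1 := re_trace_relative_part hρH hσH h1 hc
  have e2 := re_trace_cfc_mul_sub_mul_cfc hρH hσH h1 hc (fun _ => 1) (fun _ => 1)
  rw [cfc_one_matrix hρH, cfc_one_matrix hσH, one_mul, mul_one, mul_one, trace_sub,
    hρ.trace_eq_one, hσ.trace_eq_one, sub_self, Complex.zero_re] at e2
  rw [mul_one] at e1
  rw [e1]
  refine e2.trans_le ?_
  refine Finset.sum_le_sum fun i _ => Finset.sum_le_sum fun j _ => ?_
  by_cases hw : overlap hρH hσH 1 i j = 0
  · simp [hw]
  obtain ⟨v, -, -, hσv, hρv⟩ := exists_eigenvector_of_overlap_ne_zero hρH hσH h1 hc hw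
  have := mul_nonneg (overlap_nonneg hρH hσH 1 i j) <|
    bregman_nonneg (hρ.posSemidef.eigenvalues_nonneg i) (hσ.posSemidef.eigenvalues_nonneg j)
      fun h0 => hρv <| h v <| by rw [hσv, h0, Complex.ofReal_zero, zero_smul]
  linarith

lemma relativeEntropy_pinching (hP : IsStarProjection P) (hρ : IsDensity ρ) :
    relativeEntropy ρ (pinching P ρ)
      = (((ρ * (cfc Real.log ρ - cfc Real.log (pinching P ρ))).trace.re : ℝ) : EReal) :=
  if_pos fun _ hv => mulVec_eq_zero_of_pinching hP hρ.posSemidef hv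

/-- Among block-diagonal states, the pinched state is the closest one in relative entropy. -/
lemma relativeEntropy_pinching_le (hP : IsStarProjection P) (hρ : IsDensity ρ) (hσ : IsDensity σ)
    (hσP : IsBlockDiagonal P σ) :
    relativeEntropy ρ (pinching P ρ) ≤ relativeEntropy ρ σ := by
  rw [relativeEntropy_pinching hP hρ, relativeEntropy]
  split_ifs with h
  · rw [EReal.coe_le_coe_iff]
    have hK := re_trace_relative_nonneg (isDensity_pinching hP hρ) hσ
      (pinching_mulVec_eq_zero hσP h)
    have hG : Commute (cfc Real.log (pinching P ρ) - cfc Real.log σ) P :=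
      ((isBlockDiagonal_pinching hP ρ).commute.cfc_real _).sub_left (hσP.commute.cfc_real _)
    -- Both logarithms are block-diagonal, so `Πρ` may be replaced by `ρ` in front of them.
    rw [trace_pinching_mul hP hG] at hK
    simp only [mul_sub, trace_sub, Complex.sub_re] at hK ⊢
    linarith
  · exact le_top

end Main

end BlockEntropy

theorem corollary3p3 {n : Type*} [Fintype n] [DecidableEq n]
    (P ρ : Matrix n n ℂ) (hP : IsStarProjection P) (hρ : BlockEntropy.IsDensity ρ)
    (a₀ : ℝ) (ha₀ : 0 < a₀)
    (hA : (BlockEntropy.blockA P ρ - (a₀ : ℂ) • P).PosSemidef)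
    (hε_pos : 0 < BlockEntropy.leakage P ρ)
    (hε : BlockEntropy.leakage P ρ ≤ a₀ / 2) :
    ((BlockEntropy.frobeniusSq (BlockEntropy.blockB P ρ) *
          Real.log (a₀ / BlockEntropy.leakage P ρ) : ℝ) : EReal)
        ≤ BlockEntropy.relativeEntropy ρ (BlockEntropy.pinching P ρ) ∧
    ∀ σ : Matrix n n ℂ, BlockEntropy.IsDensity σ → BlockEntropy.IsBlockDiagonal P σ →
      BlockEntropy.relativeEntropy ρ (BlockEntropy.pinching P ρ)
          ≤ BlockEntropy.relativeEntropy ρ σ ∧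
      ((BlockEntropy.frobeniusSq (BlockEntropy.blockB P ρ) *
            Real.log (a₀ / BlockEntropy.leakage P ρ) : ℝ) : EReal)
          ≤ BlockEntropy.relativeEntropy ρ σ := by
  have h1 : ((BlockEntropy.frobeniusSq (BlockEntropy.blockB P ρ) *
          Real.log (a₀ / BlockEntropy.leakage P ρ) : ℝ) : EReal)
        ≤ BlockEntropy.relativeEntropy ρ (BlockEntropy.pinching P ρ) := by
    rw [BlockEntropy.relativeEntropy_pinching hP hρ, EReal.coe_le_coe_iff]
    exact BlockEntropy.frobeniusSq_mul_log_le hP hρ ha₀ hA hε_pos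
  exact ⟨h1, fun σ hσ hσP =>
    have h2 := BlockEntropy.relativeEntropy_pinching_le hP hρ hσ hσP
    ⟨h2, h1.trans h2⟩⟩
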